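/- Let $T>0$ and let $v\colon\mathbb{R}\times\mathbb{R}\times\mathbb{R}\to\mathbb{R}$, $(t,x,y)\mapsto v(t,x,y)$, be a $C^\infty$ function that is $T$-periodic in $t$. Suppose there are real numbers $a$, $b$ and $\delta>0$ such that $$v(t,x,y)\le a+b\,|y|^{2-\delta}\qquad\text{for all } t,x\in\mathbb{R} \text{ and all } y\in\mathbb{R}\setminus\{0\}.$$ Suppose also that there are two twice differentiable $T$-periodic functions $x_1,x_2\colon\mathbb{R}\to\mathbb{R}$ such that, for all $t\in\mathbb{R}$, 1. $x_1(t)<x_2(t)$, 2. $\ddot x_1(t)>v(t,x_1(t),\dot x_1(t))$, 3. $\ddot x_2(t)<v(t,x_2(t),\dot x_2(t))$. Then there is a $T$-periodic $C^2$ function $x\colon\mathbb{R}\to\mathbb{R}$ which solves $\ddot x(t)=v(t,x(t),\dot x(t))$ for all $t\in\mathbb{R}$ and satisfies $x_1(t)<x(t)<x_2(t)$ for all $t\in\mathbb{R}$. -/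

import Mathlib

open scoped ContDiff

/-- `x` is a (global, twice continuously differentiable) solution of the scalar second order
equation `x'' = v (t, x, x')` on the whole real line. -/
def IsGlobalSolution (v : ℝ → ℝ → ℝ → ℝ) (x : ℝ → ℝ) : Prop :=
  ContDiff ℝ 2 x ∧ ∀ t : ℝ, deriv (deriv x) t = v t (x t) (deriv x t)

open Set Filter Topology

/-! ### Extrema of periodic functions -/

/-! The proof uses ordered barriers `x₁ < x₂` and a truncation. Clamping the third argument of `v`
to `[-R, R]` makes the right-hand side `F` bounded and Lipschitz on a strip containing both
barriers. For large `μ`, `F t u y - μ² u` is antitone in `u`, so the map sending `u` to the periodic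
solution of `x'' - μ² x = F t u x' - μ² u` is order preserving. By the maximum principle it sends
the band between the barriers strictly into itself. A Knaster–Tarski argument gives a fixed point
(`exists_periodic_between_of_lipschitz`). The growth condition yields `x'' ≤ K (1 + x'²)`, which
bounds `x'` independently of `R` (`abs_deriv_le_of_second_deriv_le`). For `R` large the clamp is
inactive and the fixed point solves the original equation. -/

theorem Function.Periodic.exists_forall_le {T : ℝ} (hT : 0 < T) {f : ℝ → ℝ}
    (hf : Function.Periodic f T) (hc : Continuous f) : ∃ t₀, ∀ t, f t ≤ f t₀ := by
  obtain ⟨t₀, -, h⟩ := isCompact_Icc.exists_isMaxOn (nonempty_Icc.2 hT.le) hc.continuousOn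
  refine ⟨t₀, fun t => ?_⟩
  obtain ⟨s, hs, hst⟩ := hf.exists_mem_Ico₀ hT t
  rw [hst]
  exact h (Ico_subset_Icc_self hs)

theorem Function.Periodic.exists_forall_abs_le {T : ℝ} (hT : 0 < T) {f : ℝ → ℝ}
    (hf : Function.Periodic f T) (hc : Continuous f) : ∃ C, ∀ t, |f t| ≤ C := by
  obtain ⟨t₀, h⟩ := Function.Periodic.exists_forall_le (f := fun t => |f t|) hT
    (fun t => by simp only [hf t]) hc.abs
  exact ⟨_, h⟩

theorem Function.Periodic.of_hasDerivAt {T : ℝ} {f f' : ℝ → ℝ} (hf : Function.Periodic f T)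
    (h : ∀ t, HasDerivAt f (f' t) t) : Function.Periodic f' T := fun t => by
  have h1 := (h (t + T)).comp_add_const t T
  rw [show (fun s => f (s + T)) = f from funext hf] at h1
  exact h1.unique (h t)

theorem continuous_of_forall_hasDerivAt {f f' : ℝ → ℝ} (h : ∀ t, HasDerivAt f (f' t) t) :
    Continuous f :=
  continuous_iff_continuousAt.2 fun t => (h t).continuousAt

/-- At a maximum the second derivative is nonpositive. -/
theorem second_deriv_nonpos_of_forall_le {f f' : ℝ → ℝ} {c t₀ : ℝ}
    (hf : ∀ t, HasDerivAt f (f' t) t) (hf' : HasDerivAt f' c t₀) (hmax : ∀ t, f t ≤ f t₀) :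
    c ≤ 0 := by
  by_contra! hc
  have hd : deriv f = f' := funext fun t => (hf t).deriv
  have hmx : IsLocalMax f t₀ := Eventually.of_forall hmax
  have h0 : deriv f t₀ = 0 := hmx.deriv_eq_zero
  -- A maximum that is also a local minimum makes `f` locally constant, which forces `c = 0`.
  have hmin : IsLocalMin f t₀ := isLocalMin_of_deriv_deriv_pos
    (by rw [hd, hf'.deriv]; exact hc) h0 (hf t₀).continuousAt
  have he : f =ᶠ[𝓝 t₀] fun _ => f t₀ := hmin.mono fun t ht => le_antisymm (hmax t) ht
  have h1 : deriv f =ᶠ[𝓝 t₀] deriv fun _ => f t₀ := he.deriv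
  have h2 := h1.deriv_eq
  rw [hd, hf'.deriv] at h2
  simp at h2
  exact hc.ne' h2

/-! ### Comparison principles for periodic functions -/

section Comparison

variable {T : ℝ} {p p' p'' q q' q'' : ℝ → ℝ}

theorem exists_max_sub (hT : 0 < T) (hp : Function.Periodic p T) (hq : Function.Periodic q T)
    (hp1 : ∀ t, HasDerivAt p (p' t) t) (hp2 : ∀ t, HasDerivAt p' (p'' t) t)
    (hq1 : ∀ t, HasDerivAt q (q' t) t) (hq2 : ∀ t, HasDerivAt q' (q'' t) t) :
    ∃ t₀, (∀ t, p t - q t ≤ p t₀ - q t₀) ∧ p' t₀ = q' t₀ ∧ p'' t₀ ≤ q'' t₀ := by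
  have h1 : ∀ t, HasDerivAt (fun s => p s - q s) (p' t - q' t) t :=
    fun t => (hp1 t).sub (hq1 t)
  obtain ⟨t₀, ht₀⟩ := Function.Periodic.exists_forall_le (f := fun s => p s - q s) hT
    (fun t => by simp only [hp t, hq t]) (continuous_of_forall_hasDerivAt h1)
  have hmx : IsLocalMax (fun s => p s - q s) t₀ := Eventually.of_forall ht₀
  refine ⟨t₀, ht₀, sub_eq_zero.1 (hmx.hasDerivAt_eq_zero (h1 t₀)), sub_nonpos.1 ?_⟩
  exact second_deriv_nonpos_of_forall_le h1 ((hp2 t₀).sub (hq2 t₀)) ht₀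

theorem le_of_second_deriv_gt (hT : 0 < T) (hp : Function.Periodic p T)
    (hq : Function.Periodic q T)
    (hp1 : ∀ t, HasDerivAt p (p' t) t) (hp2 : ∀ t, HasDerivAt p' (p'' t) t)
    (hq1 : ∀ t, HasDerivAt q (q' t) t) (hq2 : ∀ t, HasDerivAt q' (q'' t) t)
    (h : ∀ t, p' t = q' t → q t < p t → q'' t < p'' t) (t : ℝ) : p t ≤ q t := by
  obtain ⟨t₀, hm, h1, h2⟩ := exists_max_sub hT hp hq hp1 hp2 hq1 hq2
  by_contra! hc
  exact absurd (h t₀ h1 (by linarith [hm t])) h2.not_gt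

theorem lt_of_second_deriv_gt (hT : 0 < T) (hp : Function.Periodic p T)
    (hq : Function.Periodic q T)
    (hp1 : ∀ t, HasDerivAt p (p' t) t) (hp2 : ∀ t, HasDerivAt p' (p'' t) t)
    (hq1 : ∀ t, HasDerivAt q (q' t) t) (hq2 : ∀ t, HasDerivAt q' (q'' t) t)
    (h : ∀ t, p' t = q' t → q t ≤ p t → q'' t < p'' t) (t : ℝ) : p t < q t := by
  obtain ⟨t₀, hm, h1, h2⟩ := exists_max_sub hT hp hq hp1 hp2 hq1 hq2
  by_contra! hc
  exact absurd (h t₀ h1 (by linarith [hm t])) h2.not_gt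

end Comparison

/-! ### Linear periodic equations -/

/-- At a maximum of `y²` either `y = 0` or `g = μ y`; the sign of `μ` plays no role. -/
theorem abs_mul_le_of_periodic_linear {T μ C : ℝ} (hT : 0 < T) {y g : ℝ → ℝ}
    (hy : Function.Periodic y T) (hd : ∀ t, HasDerivAt y (g t - μ * y t) t)
    (hg : ∀ t, |g t| ≤ C) (t : ℝ) : |μ| * |y t| ≤ C := by
  have h1 : ∀ t, HasDerivAt (fun s => y s ^ 2) (2 * y t * (g t - μ * y t)) t := fun t => by
    simpa [Pi.pow_def] using (hd t).pow 2
  obtain ⟨t₀, ht₀⟩ := Function.Periodic.exists_forall_le (f := fun s => y s ^ 2) hT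
    (fun t => by simp only [hy t]) (continuous_of_forall_hasDerivAt h1)
  have hmx : IsLocalMax (fun s => y s ^ 2) t₀ := Eventually.of_forall ht₀
  have h2 := hmx.hasDerivAt_eq_zero (h1 t₀)
  have hle : |y t| ≤ |y t₀| := sq_le_sq.1 (ht₀ t)
  have h3 : |μ| * |y t₀| ≤ C := by
    rcases mul_eq_zero.1 h2 with h | h
    · have : y t₀ = 0 := by linarith
      rw [this, abs_zero, mul_zero]
      exact (abs_nonneg _).trans (hg 0)
    · rw [← abs_mul, ← sub_eq_zero.1 h]
      exact hg t₀
  exact (mul_le_mul_of_nonneg_left hle (abs_nonneg _)).trans h3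

theorem exists_periodic_linear {T μ : ℝ} (hT : 0 < T) (hμ : μ ≠ 0) {g : ℝ → ℝ}
    (hg : Continuous g) (hgT : Function.Periodic g T) :
    ∃ y : ℝ → ℝ, Function.Periodic y T ∧ ∀ t, HasDerivAt y (g t - μ * y t) t := by
  have hexp : ∀ ν t : ℝ, HasDerivAt (fun s => Real.exp (ν * s)) (Real.exp (ν * t) * ν) t :=
    fun ν t => by simpa using ((hasDerivAt_id t).const_mul ν).exp
  set J : ℝ → ℝ := fun t => ∫ s in (0 : ℝ)..t, Real.exp (μ * s) * g s with hJ
  have hJd : ∀ t, HasDerivAt J (Real.exp (μ * t) * g t) t := fun t => by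
    have hcont : Continuous fun s => Real.exp (μ * s) * g s := by fun_prop
    exact hcont.integral_hasStrictDerivAt 0 t |>.hasDerivAt
  have hne : Real.exp (μ * T) - 1 ≠ 0 := by
    rw [sub_ne_zero, Ne, Real.exp_eq_one_iff]
    exact mul_ne_zero hμ hT.ne'
  -- Variation of constants, with `c` the initial value for which `y T = y 0`.
  set c : ℝ := J T / (Real.exp (μ * T) - 1) with hc
  set y : ℝ → ℝ := fun t => Real.exp (-μ * t) * (c + J t) with hy
  have hyd : ∀ t, HasDerivAt y (g t - μ * y t) t := fun t => by
    have h := (hexp (-μ) t).mul ((hJd t).const_add c)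
    refine h.congr_deriv ?_
    have h1 : Real.exp (-μ * t) * Real.exp (μ * t) = 1 := by
      rw [← Real.exp_add]; simp
    simp only [hy]
    linear_combination g t * h1
  have hyT : y T = y 0 := by
    have h0 : J 0 = 0 := by simp [hJ]
    have h1 : Real.exp (-μ * T) * Real.exp (μ * T) = 1 := by
      rw [← Real.exp_add]; simp
    have h2 : c * (Real.exp (μ * T) - 1) = J T := div_mul_cancel₀ _ hne
    simp only [hy, h0, mul_zero, Real.exp_zero, one_mul, add_zero]
    rw [← h2]
    linear_combination c * h1
  refine ⟨y, fun t => ?_, hyd⟩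
  have hz : ∀ t, HasDerivAt (fun s => Real.exp (μ * s) * (y (s + T) - y s)) 0 t := fun t => by
    have h := (hexp μ t).mul (((hyd (t + T)).comp_add_const t T).sub (hyd t))
    refine h.congr_deriv ?_
    rw [hgT t, Pi.sub_apply]
    ring
  have hconst := is_const_of_deriv_eq_zero (fun t => (hz t).differentiableAt)
    (fun t => (hz t).deriv) t 0
  simp only [zero_add, hyT, sub_self, mul_zero] at hconst
  exact sub_eq_zero.1 ((mul_eq_zero.1 hconst).resolve_left (Real.exp_pos _).ne')

/-- Factor `D² - μ² = (D + μ)(D - μ)` and solve two first-order equations. -/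
theorem exists_periodic_linear_second_order {T μ : ℝ} (hT : 0 < T) (hμ : μ ≠ 0) {g : ℝ → ℝ}
    (hg : Continuous g) (hgT : Function.Periodic g T) :
    ∃ x x' : ℝ → ℝ, Function.Periodic x T ∧ (∀ t, HasDerivAt x (x' t) t) ∧
      ∀ t, HasDerivAt x' (g t + μ ^ 2 * x t) t := by
  obtain ⟨y, hyT, hy⟩ := exists_periodic_linear hT hμ hg hgT
  obtain ⟨x, hxT, hx⟩ := exists_periodic_linear hT (neg_ne_zero.2 hμ)
    (continuous_of_forall_hasDerivAt hy) hyT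
  refine ⟨x, fun t => y t - -μ * x t, hxT, hx, fun t => ?_⟩
  refine ((hy t).sub ((hx t).const_mul (-μ))).congr_deriv ?_
  ring

theorem abs_deriv_le_of_periodic_linear_second_order {T μ C : ℝ} (hT : 0 < T) (hμ : 0 < μ)
    {x x' g : ℝ → ℝ} (hxT : Function.Periodic x T) (hx : ∀ t, HasDerivAt x (x' t) t)
    (hx' : ∀ t, HasDerivAt x' (g t + μ ^ 2 * x t) t) (hg : ∀ t, |g t| ≤ C) (t : ℝ) :
    |x' t| ≤ 2 * C / μ := by
  have hx'T := hxT.of_hasDerivAt hx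
  have hy : ∀ t, μ * |x' t - μ * x t| ≤ C := fun t => by
    have := abs_mul_le_of_periodic_linear (μ := μ) (y := fun s => x' s - μ * x s) hT
      (fun t => by simp only [hxT t, hx'T t])
      (fun t => ((hx' t).sub ((hx t).const_mul μ)).congr_deriv (by ring)) hg t
    rwa [abs_of_pos hμ] at this
  have h1 : |(-μ)| * |x t| ≤ C / μ := abs_mul_le_of_periodic_linear hT hxT
    (g := fun s => x' s - μ * x s) (fun t => (hx t).congr_deriv (by ring))
    (fun t => (le_div_iff₀' hμ).2 (hy t)) t
  rw [abs_neg, abs_of_pos hμ] at h1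
  have h2 : |x' t - μ * x t| ≤ C / μ := (le_div_iff₀' hμ).2 (hy t)
  have h3 : |x' t| ≤ |x' t - μ * x t| + μ * |x t| := by
    have := abs_add_le (x' t - μ * x t) (μ * x t)
    rwa [sub_add_cancel, abs_mul μ, abs_of_pos hμ] at this
  calc |x' t| ≤ C / μ + C / μ := by linarith
    _ = 2 * C / μ := by ring

/-! ### A semilinear periodic problem, by contraction -/

/-- The unknown of the contraction is the derivative: `z` is sent to `x'`, where `x'' = G t z + μ²
x`. The linear estimate gives Lipschitz constant `2 L / μ ≤ 1 / 2`. -/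
theorem exists_periodic_of_lipschitz {T μ L C : ℝ} (hT : 0 < T) (hμ : 0 < μ) (hL : 0 ≤ L)
    (hLμ : 4 * L ≤ μ) {G : ℝ → ℝ → ℝ} (hG : Continuous fun p : ℝ × ℝ => G p.1 p.2)
    (hGT : ∀ y, Function.Periodic (fun t => G t y) T)
    (hGL : ∀ t y z, |G t y - G t z| ≤ L * |y - z|) (hGC : ∀ t y, |G t y| ≤ C) :
    ∃ x x' : ℝ → ℝ, Function.Periodic x T ∧ (∀ t, HasDerivAt x (x' t) t) ∧
      ∀ t, HasDerivAt x' (G t (x' t) + μ ^ 2 * x t) t := by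
  have hsol : ∀ z : {z : BoundedContinuousFunction ℝ ℝ // Function.Periodic z T},
      ∃ w : {z : BoundedContinuousFunction ℝ ℝ // Function.Periodic z T}, ∃ x : ℝ → ℝ,
        Function.Periodic x T ∧ (∀ t, HasDerivAt x (w.1 t) t) ∧
        ∀ t, HasDerivAt w.1 (G t (z.1 t) + μ ^ 2 * x t) t := fun z => by
    obtain ⟨x, x', hxT, hx, hx'⟩ := exists_periodic_linear_second_order
      (g := fun t => G t (z.1 t)) hT hμ.ne'
      (hG.comp (continuous_id.prodMk z.1.continuous))
      (fun t => by simp only [z.2 t]; exact hGT _ t)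
    exact ⟨⟨BoundedContinuousFunction.ofNormedAddCommGroup x'
      (continuous_of_forall_hasDerivAt hx') (2 * C / μ)
      (abs_deriv_le_of_periodic_linear_second_order hT hμ hxT hx hx' fun t => hGC _ _),
      hxT.of_hasDerivAt hx⟩, x, hxT, hx, hx'⟩
  choose Φ X hXT hX hX' using hsol
  have hclosed : IsClosed {z : BoundedContinuousFunction ℝ ℝ | Function.Periodic z T} := by
    simp only [Function.Periodic, ofPred_forall]
    exact isClosed_iInter fun t => isClosed_eq
      (continuous_eval_const (t + T))
      (continuous_eval_const t)
  have : CompleteSpace {z : BoundedContinuousFunction ℝ ℝ // Function.Periodic z T} :=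
    hclosed.completeSpace_coe
  have : Nonempty {z : BoundedContinuousFunction ℝ ℝ // Function.Periodic z T} :=
    ⟨⟨0, fun t => rfl⟩⟩
  have hΦ : ContractingWith (1 / 2) Φ := by
    refine ⟨by norm_num, LipschitzWith.of_dist_le_mul fun z w => ?_⟩
    rw [Subtype.dist_eq, Subtype.dist_eq,
      BoundedContinuousFunction.dist_le (mul_nonneg (NNReal.coe_nonneg _) dist_nonneg)]
    intro t
    have h := abs_deriv_le_of_periodic_linear_second_order (μ := μ) (C := L * dist z.1 w.1)
      (x := fun s => X z s - X w s) (x' := fun s => (Φ z).1 s - (Φ w).1 s)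
      (g := fun s => G s (z.1 s) - G s (w.1 s)) hT hμ
      (fun t => by simp only [hXT z t, hXT w t]) (fun t => (hX z t).sub (hX w t))
      (fun t => ((hX' z t).sub (hX' w t)).congr_deriv (by ring))
      (fun t => (hGL _ _ _).trans (mul_le_mul_of_nonneg_left
        (BoundedContinuousFunction.dist_coe_le_dist (f := z.1) (g := w.1) t) hL)) t
    rw [Real.dist_eq]
    refine h.trans ?_
    rw [div_le_iff₀ hμ]
    have h2 : (0 : ℝ) ≤ dist z.1 w.1 := dist_nonneg
    push_cast
    nlinarith [mul_le_mul_of_nonneg_right hLμ h2]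
  obtain ⟨z, hz⟩ : ∃ z, Φ z = z := ⟨_, hΦ.fixedPoint_isFixedPt⟩
  have h1 := hX z
  have h2 := hX' z
  rw [hz] at h1 h2
  exact ⟨X z, z.1, hXT z, h1, h2⟩

/-! ### Lower and upper solutions for a bounded Lipschitz right-hand side -/

theorem exists_periodic_between_of_lipschitz {T A B L M : ℝ} (hT : 0 < T) (hL : 0 ≤ L)
    {F : ℝ → ℝ → ℝ → ℝ} (hF : Continuous fun p : ℝ × ℝ × ℝ => F p.1 p.2.1 p.2.2)
    (hFT : ∀ t x y, F (t + T) x y = F t x y)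
    (hFL : ∀ t, ∀ u ∈ Icc A B, ∀ w ∈ Icc A B, ∀ y z,
      |F t u y - F t w z| ≤ L * (|u - w| + |y - z|))
    (hFM : ∀ t, ∀ u ∈ Icc A B, ∀ y, |F t u y| ≤ M)
    {p p' p'' q q' q'' : ℝ → ℝ} (hpT : Function.Periodic p T) (hqT : Function.Periodic q T)
    (hp1 : ∀ t, HasDerivAt p (p' t) t) (hp2 : ∀ t, HasDerivAt p' (p'' t) t)
    (hq1 : ∀ t, HasDerivAt q (q' t) t) (hq2 : ∀ t, HasDerivAt q' (q'' t) t)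
    (hA : ∀ t, A ≤ p t) (hB : ∀ t, q t ≤ B) (hpq : ∀ t, p t < q t)
    (hlower : ∀ t, F t (p t) (p' t) < p'' t) (hupper : ∀ t, q'' t < F t (q t) (q' t)) :
    ∃ x x' : ℝ → ℝ, Function.Periodic x T ∧ (∀ t, HasDerivAt x (x' t) t) ∧
      (∀ t, HasDerivAt x' (F t (x t) (x' t)) t) ∧ ∀ t, p t < x t ∧ x t < q t := by
  -- Large enough both for the contraction (`4 L ≤ μ`) and for monotonicity (`L ≤ μ²`).
  set μ : ℝ := 4 * L + 1 with hμdef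
  have hμ : 0 < μ := by positivity
  have hLμ : L ≤ μ ^ 2 := by nlinarith
  have hband : ∀ {u : ℝ → ℝ}, (∀ t, p t ≤ u t ∧ u t ≤ q t) → ∀ t, u t ∈ Icc A B :=
    fun h t => ⟨(hA t).trans (h t).1, (h t).2.trans (hB t)⟩
  have hpb : ∀ t, p t ∈ Icc A B := hband fun t => ⟨le_rfl, (hpq t).le⟩
  have hqb : ∀ t, q t ∈ Icc A B := hband fun t => ⟨(hpq t).le, le_rfl⟩
  -- the shifted right-hand side is antitone in the second variable
  have hanti : ∀ t, ∀ u ∈ Icc A B, ∀ w ∈ Icc A B, ∀ y, u ≤ w →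
      F t w y - μ ^ 2 * w ≤ F t u y - μ ^ 2 * u := fun t u hu w hw y huw => by
    have h := (abs_le.1 (hFL t w hw u hu y y)).2
    rw [sub_self, abs_zero, add_zero, abs_of_nonneg (sub_nonneg.2 huw)] at h
    nlinarith [mul_le_mul_of_nonneg_right hLμ (sub_nonneg.2 huw)]
  set N : ℝ := M + μ ^ 2 * max |A| |B| with hN
  have hGN : ∀ t, ∀ u ∈ Icc A B, ∀ y, |F t u y - μ ^ 2 * u| ≤ N := fun t u hu y => by
    refine (abs_sub _ _).trans (add_le_add (hFM t u hu y) ?_)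
    rw [abs_mul, abs_of_nonneg (sq_nonneg μ)]
    exact mul_le_mul_of_nonneg_left (abs_le_max_abs_abs hu.1 hu.2) (sq_nonneg μ)
  -- Only the zeroth-order argument is frozen at `u`. Comparisons take place where the derivatives
  -- agree, so no monotonicity in `x'` is needed.
  set Sol : (ℝ → ℝ) → (ℝ → ℝ) → (ℝ → ℝ) → Prop := fun u x x' =>
    Function.Periodic x T ∧ (∀ t, HasDerivAt x (x' t) t) ∧
      ∀ t, HasDerivAt x' (F t (u t) (x' t) - μ ^ 2 * u t + μ ^ 2 * x t) t with hSol
  obtain ⟨Cp, hCp⟩ := (hpT.of_hasDerivAt hp1).exists_forall_abs_le hT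
    (continuous_of_forall_hasDerivAt hp2)
  set K : ℝ := max Cp (2 * N / μ) with hK
  have hlip : ∀ {f f' : ℝ → ℝ}, (∀ t, HasDerivAt f (f' t) t) → (∀ t, |f' t| ≤ K) →
      ∀ s t, |f t - f s| ≤ K * |t - s| := fun {f f'} hf hb s t =>
    Convex.norm_image_sub_le_of_norm_hasDerivWithin_le (s := univ)
      (fun x _ => (hf x).hasDerivWithinAt) (fun x _ => hb x) convex_univ trivial trivial
  -- The common Lipschitz constant `K` survives pointwise suprema, so these remain continuous.
  set Adm : (ℝ → ℝ) → Prop := fun u => Function.Periodic u T ∧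
    (∀ t, p t ≤ u t ∧ u t ≤ q t) ∧ ∀ s t, |u t - u s| ≤ K * |t - s| with hAdm
  have hcont : ∀ {u}, Adm u → Continuous u := fun {u} hu => by
    have hK0 : 0 ≤ K := by
      have := (abs_nonneg _).trans (hu.2.2 0 1)
      simpa using this
    exact (LipschitzWith.of_dist_le_mul (K := ⟨K, hK0⟩) fun a b => hu.2.2 b a).continuous
  have hex : ∀ {u}, Adm u → ∃ x x', Sol u x x' := fun {u} hu => by
    have hu' := hcont hu
    refine exists_periodic_of_lipschitz (L := L) (C := N)
      (G := fun t y => F t (u t) y - μ ^ 2 * u t) hT hμ hL (by linarith) ?_ ?_ ?_ ?_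
    · exact (hF.comp (by fun_prop : Continuous fun r : ℝ × ℝ => (r.1, u r.1, r.2))).sub
        (by fun_prop)
    · intro y t
      simp only [hu.1 t, hFT]
    · intro t y z
      have := hFL t _ (hband hu.2.1 t) _ (hband hu.2.1 t) y z
      rw [sub_self, abs_zero, zero_add] at this
      rwa [sub_sub_sub_cancel_right]
    · exact fun t y => hGN t _ (hband hu.2.1 t) y
  have hmono : ∀ {u w x x' z z'}, Adm u → Adm w → (∀ t, u t ≤ w t) → Sol u x x' →
      Sol w z z' → ∀ t, x t ≤ z t := fun {u w x x' z z'} hu hw huw hx hz =>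
    le_of_second_deriv_gt hT hx.1 hz.1 hx.2.1 hx.2.2 hz.2.1 hz.2.2 fun t he hlt => by
      rw [he]
      have h1 := hanti t _ (hband hu.2.1 t) _ (hband hw.2.1 t) (z' t) (huw t)
      have h2 := mul_lt_mul_of_pos_left hlt (pow_pos hμ 2)
      linarith
  have hmaps : ∀ {u x x'}, Adm u → Sol u x x' → ∀ t, p t < x t ∧ x t < q t :=
    fun {u x x'} hu hx t => by
    constructor
    · refine lt_of_second_deriv_gt hT hpT hx.1 hp1 hp2 hx.2.1 hx.2.2 (fun t he hle => ?_) t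
      rw [← he]
      have h1 := hanti t _ (hpb t) _ (hband hu.2.1 t) (p' t) (hu.2.1 t).1
      have h2 := mul_le_mul_of_nonneg_left hle (sq_nonneg μ)
      linarith [hlower t]
    · refine lt_of_second_deriv_gt hT hx.1 hqT hx.2.1 hx.2.2 hq1 hq2 (fun t he hle => ?_) t
      rw [he]
      have h1 := hanti t _ (hband hu.2.1 t) _ (hqb t) (q' t) (hu.2.1 t).2
      have h2 := mul_le_mul_of_nonneg_left hle (sq_nonneg μ)
      linarith [hupper t]
  have hadm : ∀ {u x x'}, Adm u → Sol u x x' → Adm x := fun {u x x'} hu hx =>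
    ⟨hx.1, fun t => ⟨(hmaps hu hx t).1.le, (hmaps hu hx t).2.le⟩, hlip hx.2.1 fun t =>
      (abs_deriv_le_of_periodic_linear_second_order hT hμ hx.1 hx.2.1 hx.2.2
        (fun t => hGN t _ (hband hu.2.1 t) _) t).trans (le_max_right _ _)⟩
  -- the supremum of all admissible `u` lying below their image is a fixed point
  set S : Set (ℝ → ℝ) := {u | Adm u ∧ ∃ x x', Sol u x x' ∧ ∀ t, u t ≤ x t} with hS
  have hpS : p ∈ S := by
    have hp : Adm p := ⟨hpT, fun t => ⟨le_rfl, (hpq t).le⟩,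
      hlip hp1 fun t => (hCp t).trans (le_max_left _ _)⟩
    obtain ⟨x, x', hx⟩ := hex hp
    exact ⟨hp, x, x', hx, fun t => (hmaps hp hx t).1.le⟩
  have : Nonempty S := ⟨⟨p, hpS⟩⟩
  set U : ℝ → ℝ := fun t => ⨆ u : S, u.1 t with hU
  have hbdd : ∀ t, BddAbove (range fun u : S => u.1 t) := fun t =>
    ⟨q t, by rintro _ ⟨u, rfl⟩; exact (u.2.1.2.1 t).2⟩
  have hle : ∀ u ∈ S, ∀ t, u t ≤ U t := fun u hu t => le_ciSup (hbdd t) ⟨u, hu⟩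
  have hUadm : Adm U := by
    refine ⟨fun t => ?_, fun t => ⟨hle p hpS t, ciSup_le fun u => (u.2.1.2.1 t).2⟩, ?_⟩
    · simp only [hU]
      exact congrArg iSup (funext fun u => u.2.1.1 t)
    · have h1 : ∀ s t, U t ≤ U s + K * |t - s| := fun s t => ciSup_le fun u => by
        have h2 := (abs_le.1 (u.2.1.2.2 s t)).2
        linarith [hle u.1 u.2 s]
      intro s t
      rw [abs_le]
      have h2 := h1 s t
      have h3 := h1 t s
      rw [abs_sub_comm] at h3
      constructor <;> linarith
  obtain ⟨x, x', hx⟩ := hex hUadm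
  have hUx : ∀ t, U t ≤ x t := fun t => ciSup_le fun u => by
    obtain ⟨hu, z, z', hz, huz⟩ := u.2
    exact (huz t).trans (hmono hu hUadm (hle u.1 u.2) hz hx t)
  have hxadm := hadm hUadm hx
  -- Monotonicity puts the image `x` of `U` back in `S`, so `x ≤ U`.
  have hxS : x ∈ S := by
    obtain ⟨z, z', hz⟩ := hex hxadm
    exact ⟨hxadm, z, z', hz, hmono hUadm hxadm hUx hx hz⟩
  have hUeq : U = x := funext fun t => le_antisymm (hUx t) (hle x hxS t)
  refine ⟨x, x', hx.1, hx.2.1, fun t => (hx.2.2 t).congr_deriv ?_, hmaps hUadm hx⟩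
  rw [hUeq]
  ring

/-! ### A priori bound on the derivative -/

/-- A one-sided quadratic growth condition bounds the derivative of a periodic function from
both sides: `x' * exp (-2 * K * x)` has all its critical points where `|x'| ≤ 1`. -/
theorem abs_deriv_le_of_second_deriv_le {T K A B : ℝ} (hT : 0 < T) (hK : 0 < K)
    {x x' x'' : ℝ → ℝ} (hxT : Function.Periodic x T) (hx : ∀ t, HasDerivAt x (x' t) t)
    (hx' : ∀ t, HasDerivAt x' (x'' t) t) (hb : ∀ t, x t ∈ Icc A B)
    (h : ∀ t, x'' t ≤ K * (1 + x' t ^ 2)) (t : ℝ) :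
    |x' t| ≤ Real.exp (2 * K * (B - A)) := by
  have hx'T := hxT.of_hasDerivAt hx
  have hd : ∀ t, HasDerivAt (fun s => (x' s * Real.exp (-2 * K * x s)) ^ 2)
      (2 * (x' t * Real.exp (-2 * K * x t)) *
        ((x'' t - 2 * K * x' t ^ 2) * Real.exp (-2 * K * x t))) t := fun t => by
    have h1 := ((hx' t).mul ((hx t).const_mul (-2 * K)).exp).pow 2
    refine h1.congr_deriv ?_
    simp only [Pi.mul_apply]
    push_cast
    ring
  obtain ⟨t₀, ht₀⟩ := Function.Periodic.exists_forall_le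
    (f := fun s => (x' s * Real.exp (-2 * K * x s)) ^ 2) hT
    (fun t => by simp only [hxT t, hx'T t]) (continuous_of_forall_hasDerivAt hd)
  have hmx : IsLocalMax (fun s => (x' s * Real.exp (-2 * K * x s)) ^ 2) t₀ :=
    Eventually.of_forall ht₀
  have h0 := hmx.hasDerivAt_eq_zero (hd t₀)
  have hone : |x' t₀| ≤ 1 := by
    rw [← sq_le_one_iff_abs_le_one]
    have hE := Real.exp_pos (-2 * K * x t₀)
    rcases mul_eq_zero.1 h0 with h1 | h1
    · have : x' t₀ = 0 := by
        rcases mul_eq_zero.1 ((mul_eq_zero.1 h1).resolve_left two_ne_zero) with h2 | h2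
        · exact h2
        · exact absurd h2 hE.ne'
      rw [this]
      norm_num
    -- Here `x'' = 2 K x'²`, and `x'' ≤ K (1 + x'²)` leaves `x'² ≤ 1`.
    · have h2 := (mul_eq_zero.1 h1).resolve_right hE.ne'
      nlinarith [h t₀]
  have hle := sq_le_sq.1 (ht₀ t)
  rw [abs_mul, abs_mul, Real.abs_exp, Real.abs_exp] at hle
  have h1 : |x' t| * Real.exp (-2 * K * x t) ≤ Real.exp (-2 * K * x t₀) :=
    hle.trans (mul_le_of_le_one_left (Real.exp_pos _).le hone)
  calc |x' t| = |x' t| * Real.exp (-2 * K * x t) * Real.exp (2 * K * x t) := by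
        rw [mul_assoc, ← Real.exp_add]
        simp
    _ ≤ Real.exp (-2 * K * x t₀) * Real.exp (2 * K * x t) :=
        mul_le_mul_of_nonneg_right h1 (Real.exp_pos _).le
    _ = Real.exp (2 * K * (x t - x t₀)) := by
        rw [← Real.exp_add]
        ring_nf
    _ ≤ Real.exp (2 * K * (B - A)) := by
        gcongr
        · exact (hb t).2
        · exact (hb t₀).1

/-! ### Bounds for periodic right-hand sides on compact sets -/

theorem exists_forall_mem_Icc_abs_le {T : ℝ} (hT : 0 < T) {v : ℝ → ℝ → ℝ → ℝ}
    (hv : Continuous fun p : ℝ × ℝ × ℝ => v p.1 p.2.1 p.2.2) (hvT : Function.Periodic v T)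
    (A B R : ℝ) : ∃ C, ∀ t, ∀ x ∈ Icc A B, ∀ y ∈ Icc (-R) R, |v t x y| ≤ C := by
  obtain ⟨C, hC⟩ := (isCompact_Icc.prod (isCompact_Icc.prod isCompact_Icc) :
    IsCompact (Icc 0 T ×ˢ Icc A B ×ˢ Icc (-R) R)).exists_bound_of_continuousOn hv.continuousOn
  refine ⟨C, fun t x hx y hy => ?_⟩
  obtain ⟨s, hs, hst⟩ := hvT.exists_mem_Ico₀ hT t
  rw [hst]
  exact hC (s, x, y) ⟨Ico_subset_Icc_self hs, hx, hy⟩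

theorem exists_forall_mem_Icc_abs_sub_le {T : ℝ} (hT : 0 < T) {v : ℝ → ℝ → ℝ → ℝ}
    (hv : ContDiff ℝ 1 fun p : ℝ × ℝ × ℝ => v p.1 p.2.1 p.2.2) (hvT : Function.Periodic v T)
    (A B R : ℝ) : ∃ L, 0 ≤ L ∧ ∀ t, ∀ u ∈ Icc A B, ∀ w ∈ Icc A B, ∀ y ∈ Icc (-R) R,
      ∀ z ∈ Icc (-R) R, |v t u y - v t w z| ≤ L * (|u - w| + |y - z|) := by
  obtain ⟨L, hL⟩ := (hv.locallyLipschitz.locallyLipschitzOn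
    (s := Icc 0 T ×ˢ Icc A B ×ˢ Icc (-R) R)).exists_lipschitzOnWith_of_compact
    (isCompact_Icc.prod (isCompact_Icc.prod isCompact_Icc))
  refine ⟨L, L.2, fun t u hu w hw y hy z hz => ?_⟩
  obtain ⟨s, hs, hst⟩ := hvT.exists_mem_Ico₀ hT t
  rw [hst]
  have h := hL.dist_le_mul (s, u, y) ⟨Ico_subset_Icc_self hs, hu, hy⟩ (s, w, z)
    ⟨Ico_subset_Icc_self hs, hw, hz⟩
  refine h.trans (mul_le_mul_of_nonneg_left ?_ L.2)
  rw [Prod.dist_eq, Prod.dist_eq, dist_self, Real.dist_eq, Real.dist_eq]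
  exact max_le (by positivity) (max_le (by linarith [abs_nonneg (y - z)])
    (by linarith [abs_nonneg (u - w)]))

/-- Subquadratic growth away from `y = 0` gives a global quadratic bound on a strip. -/
theorem exists_forall_le_mul_one_add_sq {T a b δ : ℝ} (hT : 0 < T) (hδ : 0 < δ)
    {v : ℝ → ℝ → ℝ → ℝ} (hv : Continuous fun p : ℝ × ℝ × ℝ => v p.1 p.2.1 p.2.2)
    (hvT : Function.Periodic v T)
    (hgrowth : ∀ t x y : ℝ, y ≠ 0 → v t x y ≤ a + b * |y| ^ (2 - δ)) (A B : ℝ) :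
    ∃ K, 0 < K ∧ ∀ t, ∀ x ∈ Icc A B, ∀ y, v t x y ≤ K * (1 + y ^ 2) := by
  obtain ⟨C, hC⟩ := exists_forall_mem_Icc_abs_le hT hv hvT A B 1
  refine ⟨|a| + |b| + |C| + 1, by positivity, fun t x hx y => ?_⟩
  have ha := abs_nonneg a
  have hb := abs_nonneg b
  have hc := abs_nonneg C
  have hy2 := sq_nonneg y
  rcases le_total |y| 1 with hy | hy
  · have h1 := (le_abs_self _).trans (hC t x hx y (abs_le.1 hy))
    nlinarith [le_abs_self C]
  · have hy0 : y ≠ 0 := fun h => by rw [h, abs_zero] at hy; linarith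
    have h1 : |y| ^ (2 - δ) ≤ y ^ 2 := by
      rw [← sq_abs, ← Real.rpow_natCast]
      exact Real.rpow_le_rpow_of_exponent_le hy (by push_cast; linarith)
    have h2 : b * |y| ^ (2 - δ) ≤ |b| * y ^ 2 :=
      (mul_le_mul_of_nonneg_right (le_abs_self b) (by positivity)).trans
        (mul_le_mul_of_nonneg_left h1 hb)
    have h3 := hgrowth t x y hy0
    nlinarith [le_abs_self a]

/-! ### Truncation in the derivative variable, and the main theorem -/

theorem clamp_mem_Icc {R : ℝ} (hR : 0 ≤ R) (y : ℝ) : max (-R) (min y R) ∈ Icc (-R) R :=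
  ⟨le_max_left _ _, max_le (by linarith) (min_le_right _ _)⟩

theorem clamp_eq_self {R y : ℝ} (h : |y| ≤ R) : max (-R) (min y R) = y := by
  rw [min_eq_left (abs_le.1 h).2, max_eq_right (abs_le.1 h).1]

theorem abs_clamp_sub_clamp_le (R y z : ℝ) :
    |max (-R) (min y R) - max (-R) (min z R)| ≤ |y - z| :=
  calc |max (-R) (min y R) - max (-R) (min z R)| ≤ |min y R - min z R| := by
        simpa using abs_max_sub_max_le_max (-R) (min y R) (-R) (min z R)
    _ ≤ |y - z| := by simpa using abs_min_sub_min_le_max y R z R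

theorem clamp_sq_le {R : ℝ} (hR : 0 ≤ R) (y : ℝ) : max (-R) (min y R) ^ 2 ≤ y ^ 2 := by
  rw [sq_le_sq]
  have := abs_clamp_sub_clamp_le R y 0
  rwa [clamp_eq_self (y := 0) (by rwa [abs_zero]), sub_zero, sub_zero] at this

theorem theorem3p2
    (v : ℝ → ℝ → ℝ → ℝ)
    (hv : ContDiff ℝ ∞ (fun p : ℝ × ℝ × ℝ => v p.1 p.2.1 p.2.2))
    (T : ℝ) (hT : 0 < T)
    (hvT : ∀ t x y : ℝ, v (t + T) x y = v t x y)
    (x₁ x₂ : ℝ → ℝ)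
    (hx₁ : Differentiable ℝ x₁) (hx₁' : Differentiable ℝ (deriv x₁))
    (hx₂ : Differentiable ℝ x₂) (hx₂' : Differentiable ℝ (deriv x₂))
    (hx₁T : Function.Periodic x₁ T) (hx₂T : Function.Periodic x₂ T)
    (hlt : ∀ t : ℝ, x₁ t < x₂ t)
    (hlower : ∀ t : ℝ, deriv (deriv x₁) t > v t (x₁ t) (deriv x₁ t))
    (hupper : ∀ t : ℝ, deriv (deriv x₂) t < v t (x₂ t) (deriv x₂ t))
    (a b δ : ℝ) (hδ : 0 < δ)
    (hgrowth : ∀ t x y : ℝ, y ≠ 0 → v t x y ≤ a + b * |y| ^ (2 - δ)) :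
    ∃ x : ℝ → ℝ, IsGlobalSolution v x ∧ Function.Periodic x T ∧
      ∀ t : ℝ, x₁ t < x t ∧ x t < x₂ t := by
  have hvT' : Function.Periodic v T := fun t => funext fun x => funext fun y => hvT t x y
  have hp1 : ∀ t, HasDerivAt x₁ (deriv x₁ t) t := fun t => (hx₁ t).hasDerivAt
  have hp2 : ∀ t, HasDerivAt (deriv x₁) (deriv (deriv x₁) t) t := fun t => (hx₁' t).hasDerivAt
  have hq1 : ∀ t, HasDerivAt x₂ (deriv x₂ t) t := fun t => (hx₂ t).hasDerivAt
  have hq2 : ∀ t, HasDerivAt (deriv x₂) (deriv (deriv x₂) t) t := fun t => (hx₂' t).hasDerivAt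
  obtain ⟨A, hA⟩ := hx₁T.exists_forall_abs_le hT hx₁.continuous
  obtain ⟨B, hB⟩ := hx₂T.exists_forall_abs_le hT hx₂.continuous
  obtain ⟨R₁, hR₁⟩ := (hx₁T.of_hasDerivAt hp1).exists_forall_abs_le hT hx₁'.continuous
  obtain ⟨R₂, hR₂⟩ := (hx₂T.of_hasDerivAt hq1).exists_forall_abs_le hT hx₂'.continuous
  obtain ⟨K, hK, hvK⟩ :=
    exists_forall_le_mul_one_add_sq hT hδ hv.continuous hvT' hgrowth (-A) B
  -- `R₁` and `R₂` keep the barrier inequalities intact under the clamp; the exponential is the a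
  -- priori bound.
  set R : ℝ := max (max R₁ R₂) (Real.exp (2 * K * (B - -A))) with hRdef
  have hR : 0 ≤ R := (Real.exp_pos _).le.trans (le_max_right _ _)
  have hR₁' : ∀ t, |deriv x₁ t| ≤ R := fun t =>
    (hR₁ t).trans ((le_max_left _ _).trans (le_max_left _ _))
  have hR₂' : ∀ t, |deriv x₂ t| ≤ R := fun t =>
    (hR₂ t).trans ((le_max_right _ _).trans (le_max_left _ _))
  obtain ⟨L, hL0, hL⟩ := exists_forall_mem_Icc_abs_sub_le hT
    (hv.of_le (by exact_mod_cast le_top)) hvT' (-A) B R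
  obtain ⟨M, hM⟩ := exists_forall_mem_Icc_abs_le hT hv.continuous hvT' (-A) B R
  obtain ⟨x, x', hxT, hx, hx', hbetween⟩ := exists_periodic_between_of_lipschitz
    (A := -A) (B := B) (L := L) (M := M) (F := fun t u y => v t u (max (-R) (min y R))) hT hL0
    (hv.continuous.comp (by fun_prop :
      Continuous fun r : ℝ × ℝ × ℝ => (r.1, r.2.1, max (-R) (min r.2.2 R))))
    (fun t u y => hvT _ _ _)
    (fun t u hu w hw y z =>
      (hL t u hu w hw _ (clamp_mem_Icc hR y) _ (clamp_mem_Icc hR z)).trans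
        (mul_le_mul_of_nonneg_left (add_le_add le_rfl (abs_clamp_sub_clamp_le R y z)) hL0))
    (fun t u hu y => hM t u hu _ (clamp_mem_Icc hR y))
    hx₁T hx₂T hp1 hp2 hq1 hq2 (fun t => (abs_le.1 (hA t)).1) (fun t => (abs_le.1 (hB t)).2) hlt
    (fun t => by simpa only [clamp_eq_self (hR₁' t)] using hlower t)
    (fun t => by simpa only [clamp_eq_self (hR₂' t)] using hupper t)
  have hxb : ∀ t, x t ∈ Icc (-A) B := fun t =>
    ⟨(abs_le.1 (hA t)).1.trans (hbetween t).1.le, (hbetween t).2.le.trans (abs_le.1 (hB t)).2⟩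
  -- Clamping does not increase `y²`, so the truncated equation obeys the growth bound with the same
  -- `K`, which was fixed before `R`.
  have hbound : ∀ t, |x' t| ≤ R := fun t =>
    (abs_deriv_le_of_second_deriv_le hT hK hxT hx hx' hxb (fun t =>
      (hvK t _ (hxb t) _).trans (mul_le_mul_of_nonneg_left
        (add_le_add le_rfl (clamp_sq_le hR _)) hK.le)) t).trans (le_max_right _ _)
  simp only [clamp_eq_self (hbound _)] at hx'
  have hdx : deriv x = x' := funext fun t => (hx t).deriv
  have hdx' : deriv x' = fun t => v t (x t) (x' t) := funext fun t => (hx' t).deriv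
  have hxc := continuous_of_forall_hasDerivAt hx
  have hxc' := continuous_of_forall_hasDerivAt hx'
  refine ⟨x, ⟨?_, fun t => by rw [hdx, hdx']⟩, hxT, hbetween⟩
  rw [show (2 : WithTop ℕ∞) = 1 + 1 by norm_num, contDiff_succ_iff_deriv, hdx,
    contDiff_one_iff_deriv, hdx']
  exact ⟨fun t => (hx t).differentiableAt, by simp, fun t => (hx' t).differentiableAt,
    hv.continuous.comp (by fun_prop : Continuous fun t => (t, x t, x' t))⟩
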